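/- Fix $d\ge 2$. A $d$-ary tree is a rooted tree in which every internal vertex has at least two and at most $d$ children; the empty tree is also allowed. Write $\|T\|$ for the number of leaves of $T$. A set $S$ of leaves of $T$ induces a tree: take the smallest subtree containing $S$ and suppress all vertices with only one child. Let $c(D,T)$ be the number of sets of $\|D\|$ leaves of $T$ inducing a tree isomorphic (as a rooted tree) to $D$ (so $c(D,T)=1$ if $D$ is empty), let $\gamma(D,T)=c(D,T)/\binom{\|T\|}{\|D\|}$, and let $$I_d(D)=\limsup_{n\to\infty}\ \max_{\substack{\|T\|=n\\ T\ d\text{-ary tree}}}\gamma(D,T).$$ Let $H_0^d$ be the one-vertex tree and, for $n>0$ with $n-1=ds+b$, $0\le b\le d-1$, let $H_n^d$ be the tree whose root has $d$ branches, namely $d-b$ copies of $H_s^d$ and $b$ copies of $H_{s+1}^d$. Put $\eta_d(D)=\lim_{n\to\infty}\gamma(D,H_n^d)$. Let $D$ be a $d$-ary tree with branches $D_1,\dots,D_d$ (the components left when the root is removed, padded with empty trees to $d$ of them; all of them are empty if $\|D\|\le 1$). Let $|M(D)|$ be the number of equivalence classes of permutations of $\{1,\dots,d\}$ under the relation: $\pi\sim\pi'$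 if $D_{\pi(j)}$ and $D_{\pi'(j)}$ are isomorphic for every $j$. Suppose that $D$ is balanced, i.e. $\big|\|D_i\|-\|D_j\|\big|\le 1$ for all $i,j$. Then, if $\|D\|\ge 2$, $$I_d(D)\le \frac{|M(D)|}{d^{\|D\|}-d}\binom{\|D\|}{\|D_1\|,\dots,\|D_d\|}\prod_{i=1}^d I_d(D_i).$$ Furthermore, if $I_d(D_i)=\eta_d(D_i)$ for all $i$, then the limit defining $\eta_d(D)$ exists and $I_d(D)=\eta_d(D)$. -/

import Mathlib

open Filter Topology

/-- Rooted trees presented by their `d` branches at every internal vertex, where some of the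
branches may be the empty tree. A `d`-ary tree (every internal vertex has at least two and at most
`d` children) is a term satisfying `DTree.IsDary` below; up to the order of the branches
(`DTree.Iso`) these are exactly the `d`-ary trees together with the empty tree. -/
inductive DTree (d : ℕ) : Type
  | empty : DTree d
  | leaf : DTree d
  | node : (Fin d → DTree d) → DTree d

namespace DTree

variable {d : ℕ}

/-- Every internal vertex has at least two (and automatically at most `d`) children. -/
def IsDary : DTree d → Prop
  | empty => True
  | leaf => True
  | node f => (∃ i j, i ≠ j ∧ f i ≠ empty ∧ f j ≠ empty) ∧ ∀ i, (f i).IsDary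

/-- The size of a tree: its number of leaves. -/
def numLeaves : DTree d → ℕ
  | empty => 0
  | leaf => 1
  | node f => ∑ i, (f i).numLeaves

/-- The type of leaves of a tree. -/
def Leaf : DTree d → Type
  | empty => Empty
  | leaf => Unit
  | node f => Σ i, (f i).Leaf

/-- The only leaf of the one-vertex tree. -/
def onlyLeaf : (leaf : DTree d).Leaf := ()

/-- A leaf of the `i`-th branch, as a leaf of the whole tree. -/
def inBranch (f : Fin d → DTree d) (i : Fin d) (x : (f i).Leaf) : (node f).Leaf := ⟨i, x⟩

/-- The branches of a tree. The empty tree and the one-vertex tree have only empty branches. -/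
def branches : DTree d → Fin d → DTree d
  | empty, _ => empty
  | leaf, _ => empty
  | node f, i => f i

/-- Root-preserving isomorphism: the branches (including empty ones) agree up to isomorphism
after a permutation. -/
def Iso : DTree d → DTree d → Prop
  | empty, empty => True
  | leaf, leaf => True
  | node f, node g => ∃ σ : Equiv.Perm (Fin d), ∀ i, (f i).Iso (g (σ i))
  | _, _ => False

theorem Iso.refl : ∀ T : DTree d, T.Iso T
  | empty => trivial
  | leaf => trivial
  | node f => ⟨1, fun i => Iso.refl (f i)⟩

theorem Iso.symm : ∀ {S T : DTree d}, S.Iso T → T.Iso S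
  | empty, empty, _ => trivial
  | leaf, leaf, _ => trivial
  | node f, node g, h => by
      obtain ⟨σ, hσ⟩ := h
      exact ⟨σ.symm, fun i => Iso.symm (S := f (σ.symm i)) (by simpa using hσ (σ.symm i))⟩

theorem Iso.trans : ∀ {R S T : DTree d}, R.Iso S → S.Iso T → R.Iso T
  | empty, empty, empty, _, _ => trivial
  | leaf, leaf, leaf, _, _ => trivial
  | node _, node _, node _, h₁, h₂ => by
      obtain ⟨σ, hσ⟩ := h₁
      obtain ⟨τ, hτ⟩ := h₂
      exact ⟨σ.trans τ, fun i => Iso.trans (hσ i) (hτ (σ i))⟩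

open Classical in
/-- The tree with the given branches, where a root with a single child is suppressed. -/
noncomputable def joinBranches (f : Fin d → DTree d) : DTree d :=
  if ∃ i j, i ≠ j ∧ f i ≠ empty ∧ f j ≠ empty then node f
  else if h : ∃ i, f i ≠ empty then f h.choose
  else empty

open Classical in
/-- The subtree of `T` induced by a set `S` of leaves: restrict to the smallest subtree that
contains `S` and suppress all vertices with only one child. -/
noncomputable def induced : (T : DTree d) → Set T.Leaf → DTree d
  | empty, _ => empty
  | leaf, S => if onlyLeaf ∈ S then leaf else empty
  | node f, S => joinBranches fun i => (f i).induced {x | inBranch f i x ∈ S}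

/-- `c(D, T)`: the number of sets of `‖D‖` leaves of `T` that induce a tree isomorphic to `D`. -/
noncomputable def copies (D T : DTree d) : ℕ :=
  {S : Set T.Leaf | S.ncard = D.numLeaves ∧ (T.induced S).Iso D}.ncard

/-- The density `γ(D, T)`. -/
noncomputable def density (D T : DTree d) : ℝ :=
  (copies D T : ℝ) / (T.numLeaves.choose D.numLeaves : ℝ)

/-- The maximum of `γ(D, T)` over all `d`-ary trees `T` with `n` leaves (a finite set of values
in `[0, 1]`). -/
noncomputable def maxDensity (D : DTree d) (n : ℕ) : ℝ :=
  sSup {x : ℝ | ∃ T : DTree d, T.IsDary ∧ T.numLeaves = n ∧ x = density D T}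

/-- The `d`-ary inducibility `I_d(D)`. -/
noncomputable def inducibility (D : DTree d) : ℝ :=
  limsup (fun n : ℕ => maxDensity D n) atTop

/-- The even strictly `d`-ary trees `H_n^d`: `H_0^d` is a single leaf and, for `n = ds + b` with
`0 ≤ b < d`, the tree `H_{n+1}^d` has `d - b` branches `H_s^d` followed by `b` branches
`H_{s+1}^d`. -/
def evenStrict (d : ℕ) : ℕ → DTree d
  | 0 => leaf
  | n + 1 => node fun i : Fin d =>
      if _h : (i : ℕ) < d - n % d then evenStrict d (n / d) else evenStrict d (n / d + 1)
termination_by n => n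
decreasing_by
  · exact Nat.lt_succ_of_le (Nat.div_le_self n d)
  · have _hi := i.isLt
    have h1 : n % d ≠ 0 := by omega
    have h2 : n ≠ 0 := by rintro rfl; simp at h1
    have h3 : 2 ≤ d := by
      have : n % d < d := Nat.mod_lt _ (by omega)
      omega
    have := Nat.div_lt_self (Nat.pos_of_ne_zero h2) h3
    omega

/-- `η_d(D)`, the limit of `γ(D, H_n^d)` as `n → ∞`. -/
noncomputable def eta (D : DTree d) : ℝ :=
  limUnder atTop fun n : ℕ => density D (evenStrict d n)

/-- The relation `∼_D` on permutations of `[d]`: `D_{π(j)}` and `D_{π'(j)}` are isomorphic for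
all `j`. -/
def permSetoid (D : DTree d) : Setoid (Equiv.Perm (Fin d)) where
  r π π' := ∀ j, (D.branches (π j)).Iso (D.branches (π' j))
  iseqv := ⟨fun _ _ => Iso.refl _, fun h j => (h j).symm, fun h₁ h₂ j => (h₁ j).trans (h₂ j)⟩

/-- `|M(D)|`, the number of equivalence classes of `∼_D`. -/
noncomputable def cardM (D : DTree d) : ℕ :=
  Nat.card (Quotient (permSetoid D))

/-- The numbers of leaves of any two of the `d` branches (some possibly empty) differ by at
most one. -/
def IsBalanced (D : DTree d) : Prop :=
  ∀ i j, |((D.branches i).numLeaves : ℤ) - ((D.branches j).numLeaves : ℤ)| ≤ 1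

end DTree

/-! ### Leaf sets, induced trees and copies -/

namespace DTree

variable {d : ℕ}

/-! Everything rests on one recursion (`copies_node`). Let `D` have branches `D_i`, `k` leaves and
at least two nonempty branches. A copy of `D` in a tree with branches `T_i` either lies in a single
`T_i`, or splits as copies of `D_{π(i)}` in `T_i`, with `π` determined up to `∼_D`.

Upper bound. Replacing each leaf by a large tree shows that `c(E, T) ≤ I(E) ‖T‖^e / e!` for every
`T` and every `d`-ary `E` with `e` leaves, with no error term (`copies_le`). In the recursion this
leaves a sum over classes of monomials in `x_i = ‖T_i‖` with the exponents `‖D_{π(i)}‖`. For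
balanced exponents Muirhead's inequality makes the symmetrized monomial the least of its degree.
Comparing it with each of the `d^k - d` nonconstant words in the expansion of `(∑ x_i)^k` bounds the
class sum by `|M| / (d^k - d) * ((∑ x_i)^k - ∑ x_i^k)` (`sum_class_mul_le`). The subtracted powers
are exactly what induction spends on copies inside single branches, so `c(D, T) ≤ C ‖T‖^k`
(`copies_node_le`); dividing by the binomial coefficient gives the claim.

Even trees. Their branches each carry asymptotically `1/d` of the leaves, so the densities satisfy a
recursion with weights tending to `d^{-k}`, a contraction because `d * d^{-k} < 1`. By induction on
`D` they converge, and the limit obeys the upper bound's formula with equality, with `η` in place of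
`I` (`eta_node`). As `η ≤ I` always, equality on the branches forces equality for `D`. -/

theorem finite_leaf : ∀ T : DTree d, Finite T.Leaf
  | empty => inferInstanceAs (Finite Empty)
  | leaf => inferInstanceAs (Finite Unit)
  | node f => by
      have : ∀ i, Finite (f i).Leaf := fun i => finite_leaf (f i)
      exact inferInstanceAs (Finite (Σ i, (f i).Leaf))

instance (T : DTree d) : Finite T.Leaf := finite_leaf T

noncomputable instance (T : DTree d) : Fintype T.Leaf := Fintype.ofFinite _

theorem natCard_leaf : ∀ T : DTree d, Nat.card T.Leaf = T.numLeaves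
  | empty => Nat.card_of_isEmpty (α := Empty)
  | leaf => Nat.card_unique (α := Unit)
  | node f => by
      have : Nat.card (Σ i, (f i).Leaf) = ∑ i, (f i).numLeaves := by
        rw [Nat.card_sigma]
        exact Finset.sum_congr rfl fun i _ => natCard_leaf (f i)
      exact this

theorem Iso.numLeaves_eq : ∀ {S T : DTree d}, S.Iso T → S.numLeaves = T.numLeaves
  | empty, empty, _ => rfl
  | leaf, leaf, _ => rfl
  | node f, node g, ⟨σ, hσ⟩ => by
      simp only [numLeaves]
      rw [← Equiv.sum_comp σ fun i => (g i).numLeaves]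
      exact Finset.sum_congr rfl fun i _ => Iso.numLeaves_eq (hσ i)

theorem iso_empty_iff {T : DTree d} : T.Iso empty ↔ T = empty := by
  cases T <;> simp [Iso]

theorem Iso.eq_empty_iff {S T : DTree d} (h : S.Iso T) : S = empty ↔ T = empty := by
  cases S <;> cases T <;> simp_all [Iso]

theorem IsDary.numLeaves_pos : ∀ {T : DTree d}, T.IsDary → T ≠ empty → 0 < T.numLeaves
  | empty, _, h => (h rfl).elim
  | leaf, _, _ => Nat.one_pos
  | node f, ⟨⟨i, _, _, hi, _⟩, h⟩, _ =>
      (IsDary.numLeaves_pos (h i) hi).trans_le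
        (Finset.single_le_sum (f := fun i => (f i).numLeaves) (fun _ _ => Nat.zero_le _)
          (Finset.mem_univ i))

theorem two_le_numLeaves_node {f : Fin d → DTree d} (h : (node f).IsDary) :
    2 ≤ (node f).numLeaves := by
  obtain ⟨⟨i, j, hij, hi, hj⟩, h⟩ := h
  have h1 := (h i).numLeaves_pos hi
  have h2 := (h j).numLeaves_pos hj
  have : ∑ l ∈ {i, j}, (f l).numLeaves ≤ ∑ l, (f l).numLeaves :=
    Finset.sum_le_sum_of_subset (Finset.subset_univ _)
  rw [Finset.sum_pair hij] at this
  simp only [numLeaves]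
  omega

theorem joinBranches_of_two {f : Fin d → DTree d} (h : ∃ i j, i ≠ j ∧ f i ≠ empty ∧ f j ≠ empty) :
    joinBranches f = node f := by
  rw [joinBranches, if_pos h]

theorem joinBranches_of_one {f : Fin d → DTree d} {i : Fin d} (hi : ∀ j, j ≠ i → f j = empty) :
    joinBranches f = f i := by
  have h2 : ¬ ∃ i j, i ≠ j ∧ f i ≠ empty ∧ f j ≠ empty := by
    rintro ⟨a, b, hab, ha, hb⟩
    have h1 : a = i := by_contra fun h => ha (hi a h)
    have h2 : b = i := by_contra fun h => hb (hi b h)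
    exact hab (h1.trans h2.symm)
  rw [joinBranches, if_neg h2]
  split_ifs with h
  · have : h.choose = i := by_contra fun h' => h.choose_spec (hi _ h')
    rw [this]
  -- All branches are empty here, including `f i`.
  · push Not at h
    exact (h i).symm

theorem joinBranches_of_empty {f : Fin d → DTree d} (h : ∀ j, f j = empty) :
    joinBranches f = empty := by
  rw [joinBranches, if_neg (by simp [h]), dif_neg (by simp [h])]

theorem numLeaves_joinBranches (f : Fin d → DTree d) :
    (joinBranches f).numLeaves = ∑ i, (f i).numLeaves := by
  by_cases h : ∃ i j, i ≠ j ∧ f i ≠ empty ∧ f j ≠ empty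
  · rw [joinBranches_of_two h]; rfl
  · by_cases h' : ∃ i, f i ≠ empty
    · obtain ⟨i, hi⟩ := h'
      have hj : ∀ j, j ≠ i → f j = empty := fun j hj => by
        by_contra hne
        exact h ⟨j, i, hj, hne, hi⟩
      rw [joinBranches_of_one hj, Finset.sum_eq_single i]
      · intro j _ hji; rw [hj j hji]; rfl
      · simp
    · push Not at h'
      rw [joinBranches_of_empty h']
      simp [h', numLeaves]

theorem isDary_joinBranches {f : Fin d → DTree d} (hf : ∀ i, (f i).IsDary) :
    (joinBranches f).IsDary := by
  rw [joinBranches]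
  split_ifs with h h'
  · exact ⟨h, hf⟩
  · exact hf _
  · trivial

theorem isDary_induced : ∀ (T : DTree d) (S : Set T.Leaf), (T.induced S).IsDary
  | empty, _ => trivial
  | leaf, S => by
      rw [induced]
      split_ifs <;> trivial
  | node f, S => by
      rw [induced]
      exact isDary_joinBranches fun i => isDary_induced (f i) _

theorem numLeaves_induced : ∀ (T : DTree d) (S : Set T.Leaf), (T.induced S).numLeaves = S.ncard
  | empty, S => by
      have : IsEmpty (empty : DTree d).Leaf := inferInstanceAs (IsEmpty Empty)
      rw [Set.eq_empty_of_isEmpty S, Set.ncard_empty]; rfl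
  | leaf, S => by
      have hu : ∀ x : (leaf : DTree d).Leaf, x = onlyLeaf := fun x => Subsingleton.elim (α := Unit) x _
      rw [induced]
      split_ifs with h
      · have : S = {onlyLeaf} := Set.ext fun x => by simp [hu x, h]
        rw [this, Set.ncard_singleton]; rfl
      · have : S = ∅ := Set.ext fun x => by simp [hu x, h]
        rw [this, Set.ncard_empty]; rfl
  | node f, S => by
      rw [induced, numLeaves_joinBranches]
      have h : ∀ i, ((f i).induced {x | inBranch f i x ∈ S}).numLeaves
          = Nat.card {x // inBranch f i x ∈ S} := fun i =>
        (numLeaves_induced (f i) _).trans (Nat.card_coe_set_eq _).symm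
      simp_rw [h]
      rw [← Nat.card_sigma, ← Nat.card_coe_set_eq]
      exact Nat.card_congr
        { toFun := fun p => ⟨inBranch f p.1 p.2.1, p.2.2⟩
          invFun := fun p => ⟨p.1.1, p.1.2, p.2⟩
          left_inv := fun _ => rfl
          right_inv := fun _ => rfl }

theorem induced_eq_empty_iff {T : DTree d} {S : Set T.Leaf} : T.induced S = empty ↔ S = ∅ := by
  constructor
  · intro h
    have := numLeaves_induced T S
    rw [h] at this
    exact (Set.ncard_eq_zero S.toFinite).1 this.symm
  · rintro rfl
    by_contra h
    have := (isDary_induced T ∅).numLeaves_pos h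
    rw [numLeaves_induced, Set.ncard_empty] at this
    exact lt_irrefl _ this

open Classical in
/-- The sets of leaves of `T` that induce `D`. -/
noncomputable def inducing (D T : DTree d) : Finset (Set T.Leaf) :=
  Finset.univ.filter fun S => (T.induced S).Iso D

theorem mem_inducing {D T : DTree d} {S : Set T.Leaf} :
    S ∈ inducing D T ↔ (T.induced S).Iso D := by
  simp [inducing]

/-- The cardinality condition in `copies` is redundant: an induced tree has as many leaves as the
set inducing it. -/
theorem copies_eq_card (D T : DTree d) : copies D T = (inducing D T).card := by
  rw [← Set.ncard_coe_finset, copies]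
  congr 1
  ext S
  simp only [Set.mem_ofPred_eq, Finset.mem_coe, mem_inducing, and_iff_right_iff_imp]
  intro h
  rw [← numLeaves_induced, h.numLeaves_eq]

theorem copies_le_choose (D T : DTree d) : copies D T ≤ T.numLeaves.choose D.numLeaves := by
  classical
  have h1 : T.numLeaves = (Finset.univ : Finset T.Leaf).card := by
    rw [← natCard_leaf, Nat.card_eq_fintype_card]; rfl
  rw [h1, ← Finset.card_powersetCard, copies, ← Set.ncard_coe_finset,
    ← Set.ncard_image_of_injective (f := fun s : Finset T.Leaf => (s : Set T.Leaf)) _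
      Finset.coe_injective]
  refine Set.ncard_le_ncard ?_ (Set.toFinite _)
  rintro S ⟨hS, -⟩
  refine ⟨S.toFinset, ?_, by simp⟩
  simp [← hS, Set.ncard_eq_toFinset_card']

theorem copies_empty_left (T : DTree d) : copies empty T = 1 := by
  rw [copies_eq_card, Finset.card_eq_one]
  refine ⟨∅, ?_⟩
  ext S
  rw [mem_inducing, iso_empty_iff, induced_eq_empty_iff, Finset.mem_singleton]

theorem iso_leaf_of_numLeaves {T : DTree d} (hT : T.IsDary) (h : T.numLeaves = 1) : T = leaf := by
  cases T with
  | empty => simp [numLeaves] at h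
  | leaf => rfl
  | node f => have := two_le_numLeaves_node hT; omega

theorem copies_leaf_left (T : DTree d) : copies leaf T = T.numLeaves := by
  have : ∀ S : Set T.Leaf, S.ncard = 1 → (T.induced S).Iso leaf := fun S h => by
    rw [iso_leaf_of_numLeaves (isDary_induced T S) (by rw [numLeaves_induced, h])]
    trivial
  rw [← natCard_leaf, ← Set.ncard_univ, copies,
    ← Set.ncard_image_of_injective (f := fun x : T.Leaf => ({x} : Set T.Leaf)) _
      Set.singleton_injective]
  congr 1
  ext S
  simp only [Set.mem_ofPred_eq, Set.image_univ, Set.mem_range]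
  constructor
  · rintro ⟨h, -⟩
    obtain ⟨a, ha⟩ := Set.ncard_eq_one.1 h
    exact ⟨a, ha.symm⟩
  · rintro ⟨a, rfl⟩
    exact ⟨Set.ncard_singleton a, this _ (Set.ncard_singleton a)⟩

/-! ### The recursion for copies -/

/-- The set of leaves of a node with prescribed traces on the branches. -/
def leafSetEquiv (f : Fin d → DTree d) : Set (node f).Leaf ≃ ∀ i, Set (f i).Leaf where
  toFun S i := {x | inBranch f i x ∈ S}
  invFun F := {x | x.2 ∈ F x.1}
  left_inv _ := rfl
  right_inv _ := rfl

theorem induced_node (f : Fin d → DTree d) (S : Set (node f).Leaf) :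
    (node f).induced S = joinBranches fun i => (f i).induced (leafSetEquiv f S i) := by
  rw [induced]; rfl

/-- A tree is a copy of a given node if its branches match those of the node, or if only
one branch is nonempty and this branch is a copy. -/
theorem joinBranches_iso_node_iff {g : Fin d → DTree d} (hg : (node g).IsDary)
    (F : Fin d → DTree d) :
    (joinBranches F).Iso (node g) ↔
      (∃ σ : Equiv.Perm (Fin d), ∀ i, (F i).Iso (g (σ i))) ∨
        ∃ i, (F i).Iso (node g) ∧ ∀ j, j ≠ i → F j = empty := by
  constructor
  · intro h
    by_cases h2 : ∃ i j, i ≠ j ∧ F i ≠ empty ∧ F j ≠ empty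
    · rw [joinBranches_of_two h2] at h
      exact Or.inl h
    · right
      by_cases h' : ∃ i, F i ≠ empty
      · obtain ⟨i, hi⟩ := h'
        have hj : ∀ j, j ≠ i → F j = empty := fun j hj => by
          by_contra hne
          exact h2 ⟨j, i, hj, hne, hi⟩
        rw [joinBranches_of_one hj] at h
        exact ⟨i, h, hj⟩
      · push Not at h'
        rw [joinBranches_of_empty h'] at h
        exact h.elim
  · rintro (⟨σ, hσ⟩ | ⟨i, hi, hj⟩)
    · obtain ⟨a, b, hab, ha, hb⟩ := hg.1
      rw [joinBranches_of_two]
      · exact ⟨σ, hσ⟩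
      · refine ⟨σ.symm a, σ.symm b, by simpa using hab, ?_, ?_⟩
        · rw [Ne, (hσ (σ.symm a)).eq_empty_iff]; simpa using ha
        · rw [Ne, (hσ (σ.symm b)).eq_empty_iff]; simpa using hb
    · rwa [joinBranches_of_one hj]

noncomputable instance (D : DTree d) : Fintype (Quotient (permSetoid D)) := Fintype.ofFinite _

/-- The recursion for the number of copies. -/
theorem copies_node {g : Fin d → DTree d} (hg : (node g).IsDary) (f : Fin d → DTree d) :
    copies (node g) (node f) = ∑ i, copies (node g) (f i) +
      ∑ q : Quotient (permSetoid (node g)), ∏ i, copies (g (q.out i)) (f i) := by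
  classical
  -- Encoded by traces on the branches, the copies form a union of boxes: in one family all traces
  -- but one are empty, in the other trace `i` induces `g (q.out i)`. Cardinalities of boxes are
  -- products.
  have hmap : (inducing (node g) (node f)).map (leafSetEquiv f).toEmbedding =
      (Finset.univ.biUnion fun i => Fintype.piFinset
        (Function.update (fun j => ({∅} : Finset (Set (f j).Leaf))) i (inducing (node g) (f i)))) ∪
      Finset.univ.biUnion fun q : Quotient (permSetoid (node g)) =>
        Fintype.piFinset fun i => inducing (g (q.out i)) (f i) := by
    ext F
    simp only [Finset.mem_map_equiv, mem_inducing, induced_node, Equiv.apply_symm_apply,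
      joinBranches_iso_node_iff hg, Finset.mem_union, Finset.mem_biUnion, Finset.mem_univ,
      true_and, Fintype.mem_piFinset]
    rw [or_comm]
    refine or_congr ?_ ?_
    · refine exists_congr fun i => ?_
      constructor
      · rintro ⟨h1, h2⟩ j
        by_cases hj : j = i
        · subst hj; simpa [mem_inducing] using h1
        · simpa [hj, induced_eq_empty_iff] using h2 j hj
      · intro h
        refine ⟨by simpa [mem_inducing] using h i, fun j hj => ?_⟩
        simpa [hj, induced_eq_empty_iff] using h j
    · constructor
      · rintro ⟨σ, hσ⟩
        refine ⟨Quotient.mk _ σ, fun i => ?_⟩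
        have := Quotient.mk_out (s := permSetoid (node g)) σ
        exact (hσ i).trans (this i).symm
      · rintro ⟨q, hq⟩
        exact ⟨q.out, hq⟩
  have hne : ∀ {T : DTree d} {S : Set T.Leaf}, (T.induced S).Iso (node g) → S ≠ ∅ := by
    rintro T S h rfl
    rw [induced_eq_empty_iff.2 rfl] at h
    exact h
  rw [copies_eq_card, ← Finset.card_map (leafSetEquiv f).toEmbedding, hmap,
    Finset.card_union_of_disjoint, Finset.card_biUnion, Finset.card_biUnion]
  · congr 1
    · refine Finset.sum_congr rfl fun i _ => ?_
      rw [Fintype.card_piFinset, Finset.prod_eq_single i]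
      · simp [copies_eq_card]
      · intro j _ hj; simp [hj]
      · simp
    · simp only [Fintype.card_piFinset, copies_eq_card]
  · intro q _ q' _ hqq
    rw [Function.onFun, Finset.disjoint_left]
    intro F h1 h2
    apply hqq
    simp only [Fintype.mem_piFinset, mem_inducing] at h1 h2
    rw [← Quotient.out_equiv_out]
    exact fun i => (h1 i).symm.trans (h2 i)
  · intro i _ j _ hij
    rw [Function.onFun, Finset.disjoint_left]
    intro F h1 h2
    simp only [Fintype.mem_piFinset] at h1 h2
    have h1 := h1 i
    have h2 := h2 i
    simp only [Function.update_self, mem_inducing] at h1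
    simp only [Function.update_of_ne hij, Finset.mem_singleton] at h2
    exact hne h1 h2
  · rw [Finset.disjoint_left]
    intro F h1 h2
    simp only [Finset.mem_biUnion, Finset.mem_univ, true_and, Fintype.mem_piFinset] at h1 h2
    obtain ⟨i, hi⟩ := h1
    obtain ⟨q, hq⟩ := h2
    obtain ⟨a, b, hab, ha, hb⟩ := hg.1
    -- Two nonempty branches of the pattern would both have to be matched with the single branch `i`
    -- that meets the leaf set.
    have key : ∀ a, g a ≠ empty → q.out.symm a = i := fun a ha => by
      by_contra h
      have h1 := hi (q.out.symm a)
      have h2 := hq (q.out.symm a)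
      simp only [Function.update_of_ne h, Finset.mem_singleton] at h1
      rw [h1, mem_inducing, induced_eq_empty_iff.2 rfl, Equiv.apply_symm_apply] at h2
      exact ha ((h2.eq_empty_iff).1 rfl)
    exact hab (q.out.symm.injective ((key a ha).trans (key b hb).symm))

theorem copies_node_leaf (g : Fin d → DTree d) : copies (node g) leaf = 0 := by
  rw [copies_eq_card, Finset.card_eq_zero]
  ext S
  rw [mem_inducing, induced]
  split_ifs <;> simp [Iso]

theorem copies_node_empty (g : Fin d → DTree d) : copies (node g) empty = 0 := by
  rw [copies_eq_card, Finset.card_eq_zero]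
  ext S
  rw [mem_inducing, induced]
  simp [Iso]

/-- The equivalence classes of `∼_D` all have the same size. -/
theorem exists_card_class (D : DTree d) : ∃ w : ℕ, 0 < w ∧
    ∀ F : Equiv.Perm (Fin d) → ℝ, (∀ π π', (permSetoid D).r π π' → F π = F π') →
      (w : ℝ) * ∑ q : Quotient (permSetoid D), F q.out = ∑ σ, F σ := by
  classical
  -- The relation is invariant under precomposition, so `τ ↦ τ ∘ q.out` carries the class of the
  -- identity onto the class `q`.
  refine ⟨(Finset.univ.filter fun τ : Equiv.Perm (Fin d) => (permSetoid D).r τ 1).card,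
    Finset.card_pos.2 ⟨1, by simp⟩, fun F hF => ?_⟩
  rw [← Finset.sum_fiberwise_of_maps_to (s := Finset.univ) (t := Finset.univ)
    (g := fun σ => (Quotient.mk (permSetoid D) σ)) (fun _ _ => Finset.mem_univ _), Finset.mul_sum]
  refine Finset.sum_congr rfl fun q _ => ?_
  have h1 : ∀ σ ∈ Finset.univ.filter fun σ => Quotient.mk (permSetoid D) σ = q, F σ = F q.out := by
    intro σ hσ
    apply hF
    rw [Finset.mem_filter] at hσ
    rw [← hσ.2]
    exact (permSetoid D).symm (Quotient.mk_out σ)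
  rw [Finset.sum_congr rfl h1, Finset.sum_const, nsmul_eq_mul]
  congr 2
  refine Finset.card_bij (fun τ _ => q.out.trans τ) ?_ ?_ ?_
  · intro τ hτ
    simp only [Finset.mem_filter, Finset.mem_univ, true_and] at hτ ⊢
    conv_rhs => rw [← Quotient.out_eq q]
    exact Quotient.sound fun j => hτ (q.out j)
  · intro τ _ τ' _ h
    ext i
    have := congrArg (fun e => e (q.out.symm i)) h
    simpa using congrArg Fin.val this
  · intro σ hσ
    simp only [Finset.mem_filter, Finset.mem_univ, true_and] at hσ
    refine ⟨q.out.symm.trans σ, ?_, by ext; simp⟩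
    simp only [Finset.mem_filter, Finset.mem_univ, true_and]
    have h2 : (permSetoid D).r q.out σ := by
      apply Quotient.exact (s := permSetoid D)
      rw [Quotient.out_eq, hσ]
    intro j
    simpa using (h2 (q.out.symm j)).symm

/-! ### Blow-ups -/

/-- Replace every leaf by the tree `R`. -/
def blowup (R : DTree d) : DTree d → DTree d
  | empty => empty
  | leaf => R
  | node f => node fun i => blowup R (f i)

theorem numLeaves_blowup (R : DTree d) :
    ∀ T : DTree d, (blowup R T).numLeaves = T.numLeaves * R.numLeaves
  | empty => by simp [blowup, numLeaves]
  | leaf => by simp [blowup, numLeaves]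
  | node f => by
      simp only [blowup, numLeaves, Finset.sum_mul]
      exact Finset.sum_congr rfl fun i _ => numLeaves_blowup R (f i)

theorem blowup_ne_empty {R T : DTree d} (hR : R ≠ empty) (hT : T ≠ empty) :
    blowup R T ≠ empty := by
  cases T <;> simp_all [blowup]

theorem isDary_blowup {R : DTree d} (hR : R.IsDary) (hR' : R ≠ empty) :
    ∀ {T : DTree d}, T.IsDary → (blowup R T).IsDary
  | empty, _ => trivial
  | leaf, _ => hR
  | node _, ⟨⟨i, j, hij, hi, hj⟩, h⟩ =>
      ⟨⟨i, j, hij, blowup_ne_empty hR' hi, blowup_ne_empty hR' hj⟩,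
        fun i => isDary_blowup hR hR' (h i)⟩

/-- Each leaf of a copy can be chosen freely within the tree `R` that replaces it. Copies using
several leaves of one `R` are ignored, hence only an inequality. -/
theorem copies_mul_pow_le_copies_blowup (R T : DTree d) :
    ∀ {D : DTree d}, D.IsDary → copies D T * R.numLeaves ^ D.numLeaves ≤ copies D (blowup R T) := by
  induction T with
  | empty =>
    intro D hD
    cases D with
    | empty => simp [copies_empty_left, numLeaves]
    | leaf => simp [copies_leaf_left, numLeaves]
    | node g => simp [copies_node_empty]
  | leaf =>
    intro D hD
    cases D with
    | empty => simp [copies_empty_left, numLeaves]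
    | leaf => simp [copies_leaf_left, numLeaves, blowup]
    | node g => simp [copies_node_leaf]
  | node f ih =>
    intro D hD
    cases D with
    | empty => simp [copies_empty_left, numLeaves]
    | leaf => simp [copies_leaf_left, numLeaves_blowup, numLeaves]
    | node g =>
      rw [blowup, copies_node hD, copies_node hD, add_mul, Finset.sum_mul, Finset.sum_mul]
      refine add_le_add (Finset.sum_le_sum fun i _ => ih i hD) (Finset.sum_le_sum fun q _ => ?_)
      have : (node g).numLeaves = ∑ i, (g (q.out i)).numLeaves := by
        rw [numLeaves, Equiv.sum_comp q.out fun i => (g i).numLeaves]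
      rw [this, ← Finset.prod_pow_eq_pow_sum, ← Finset.prod_mul_distrib]
      exact Finset.prod_le_prod' fun i _ => ih i (hD.2 _)

end DTree

/-! ### Balanced exponents and Muirhead's inequality -/

/-- The symmetrized monomial with exponents `α`, as a sum over all permutations. -/
noncomputable def symMonomial {ι : Type*} [Fintype ι] [DecidableEq ι] (x : ι → ℝ) (α : ι → ℕ) : ℝ :=
  ∑ σ : Equiv.Perm ι, ∏ i, x (σ i) ^ α i

/-- A balanced sequence takes the two values `s / m`, `s / m + 1`, where `s` is the sum and `m`
the length. -/
theorem balanced_values {ι : Type*} [Fintype ι] {α : ι → ℕ} (hα : ∀ i j, α i ≤ α j + 1) (i : ι) :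
    (α i = (∑ j, α j) / Fintype.card ι ∨ α i = (∑ j, α j) / Fintype.card ι + 1) ∧
      (Finset.univ.filter fun j => α j = (∑ j, α j) / Fintype.card ι + 1).card =
        (∑ j, α j) % Fintype.card ι := by
  have hne : (Finset.univ : Finset ι).Nonempty := ⟨i, Finset.mem_univ i⟩
  obtain ⟨l, -, hl⟩ := Finset.exists_min_image Finset.univ α hne
  have hv : ∀ j, α j = α l ∨ α j = α l + 1 := fun j => by
    have h1 := hl j (Finset.mem_univ j)
    have h2 := hα j l
    omega
  have hsum : ∑ j, α j = Fintype.card ι * α l +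
      (Finset.univ.filter fun j => α j = α l + 1).card := by
    rw [Finset.card_filter, ← Finset.card_univ, ← smul_eq_mul, ← Finset.sum_const,
      ← Finset.sum_add_distrib]
    refine Finset.sum_congr rfl fun j _ => ?_
    rcases hv j with h | h <;> simp [h]
  have hlt : (Finset.univ.filter fun j => α j = α l + 1).card < Fintype.card ι := by
    rw [← Finset.card_univ]
    apply Finset.card_lt_card
    rw [Finset.filter_ssubset]
    exact ⟨l, Finset.mem_univ l, by simp⟩
  have hdiv : (∑ j, α j) / Fintype.card ι = α l := by
    rw [hsum, Nat.mul_add_div (by omega), Nat.div_eq_of_lt hlt, add_zero]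
  have hmod : (∑ j, α j) % Fintype.card ι =
      (Finset.univ.filter fun j => α j = α l + 1).card := by
    rw [hsum, Nat.mul_add_mod, Nat.mod_eq_of_lt hlt]
  rw [hdiv, hmod]
  exact ⟨hv i, rfl⟩

/-- Sum and length determine the two values of a balanced sequence and their multiplicities, so a
bijection between the positions of the larger value extends to a permutation. -/
theorem exists_perm_of_balanced {ι : Type*} [Fintype ι] {α β : ι → ℕ}
    (hα : ∀ i j, α i ≤ α j + 1)
    (hβ : ∀ i j, β i ≤ β j + 1)
    (h : ∑ i, α i = ∑ i, β i) :
    ∃ τ : Equiv.Perm ι, ∀ i, α i = β (τ i) := by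
  classical
  rcases isEmpty_or_nonempty ι with hι | ⟨⟨i₀⟩⟩
  · exact ⟨1, fun i => hι.elim i⟩
  set s := (∑ i, β i) / Fintype.card ι with hs
  have hα' := balanced_values hα
  have hβ' := balanced_values hβ
  rw [h, ← hs] at hα'
  rw [← hs] at hβ'
  have hcard : Fintype.card {j // α j = s + 1} = Fintype.card {j // β j = s + 1} := by
    rw [Fintype.card_subtype, Fintype.card_subtype, (hα' i₀).2, (hβ' i₀).2]
  refine ⟨(Fintype.equivOfCardEq hcard).extendSubtype, fun i => ?_⟩
  by_cases hi : α i = s + 1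
  · rw [hi]
    exact ((Fintype.equivOfCardEq hcard).extendSubtype_mem i hi).symm
  · have h1 := (Fintype.equivOfCardEq hcard).extendSubtype_not_mem i hi
    have h2 := (hα' i).1
    have h3 := (hβ' ((Fintype.equivOfCardEq hcard).extendSubtype i)).1
    omega

section Muirhead

variable {ι : Type*} [Fintype ι] [DecidableEq ι]

theorem symMonomial_comp_perm (x : ι → ℝ) (α : ι → ℕ) (τ : Equiv.Perm ι) :
    symMonomial x (fun i => α (τ i)) = symMonomial x α := by
  rw [symMonomial, symMonomial, ← Equiv.sum_comp (Equiv.mulRight τ)]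
  refine Finset.sum_congr rfl fun σ _ => ?_
  exact Equiv.prod_comp τ fun i => x (σ i) ^ α i

/-- With `c = a - b`, the difference of the two sides is `(uv)^b (u - v)(u^c - v^c)`, whose last two
factors have the same sign. -/
theorem pow_smoothing {u v : ℝ} (hu : 0 ≤ u) (hv : 0 ≤ v) {a b : ℕ} (h : b ≤ a) :
    u ^ a * v ^ (b + 1) + u ^ (b + 1) * v ^ a ≤ u ^ (a + 1) * v ^ b + u ^ b * v ^ (a + 1) := by
  obtain ⟨c, rfl⟩ := Nat.exists_eq_add_of_le h
  have h1 : 0 ≤ (u - v) * (u ^ c - v ^ c) := by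
    rcases le_total u v with huv | huv
    · exact mul_nonneg_of_nonpos_of_nonpos (sub_nonpos.2 huv)
        (sub_nonpos.2 (pow_le_pow_left₀ hu huv c))
    · exact mul_nonneg (sub_nonneg.2 huv) (sub_nonneg.2 (pow_le_pow_left₀ hv huv c))
  have h2 : 0 ≤ (u * v) ^ b * ((u - v) * (u ^ c - v ^ c)) :=
    mul_nonneg (pow_nonneg (mul_nonneg hu hv) b) h1
  have h3 : (u * v) ^ b * ((u - v) * (u ^ c - v ^ c)) =
      (u ^ (b + c + 1) * v ^ b + u ^ b * v ^ (b + c + 1)) -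
      (u ^ (b + c) * v ^ (b + 1) + u ^ (b + 1) * v ^ (b + c)) := by ring
  linarith

theorem prod_pow_eq_pair (y : ι → ℝ) (α : ι → ℕ) {p q : ι} (hpq : p ≠ q) :
    ∏ i, y i ^ α i = y p ^ α p * y q ^ α q * ∏ i ∈ (Finset.univ.erase p).erase q, y i ^ α i := by
  rw [mul_assoc, Finset.mul_prod_erase _ (fun i => y i ^ α i) (by simp [hpq.symm]),
    Finset.mul_prod_erase _ (fun i => y i ^ α i) (by simp)]

theorem symMonomial_smoothing {x : ι → ℝ} (hx : ∀ i, 0 ≤ x i) {α β : ι → ℕ} {p q : ι}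
    (hpq : p ≠ q) {a b : ℕ} (hab : b ≤ a) (hαp : α p = a + 1) (hαq : α q = b) (hβp : β p = a)
    (hβq : β q = b + 1) (h : ∀ i, i ≠ p → i ≠ q → β i = α i) :
    symMonomial x β ≤ symMonomial x α := by
  -- Pairing `σ` with `σ ∘ swap p q` isolates the two exponents that change.
  have key : ∀ γ : ι → ℕ, 2 * symMonomial x γ = ∑ σ : Equiv.Perm ι,
      (x (σ p) ^ γ p * x (σ q) ^ γ q + x (σ q) ^ γ p * x (σ p) ^ γ q) *
        ∏ i ∈ (Finset.univ.erase p).erase q, x (σ i) ^ γ i := by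
    intro γ
    have h2 : symMonomial x γ = ∑ σ : Equiv.Perm ι, ∏ i, x (σ (Equiv.swap p q i)) ^ γ i := by
      rw [symMonomial, ← Equiv.sum_comp (Equiv.mulRight (Equiv.swap p q))]
      rfl
    rw [two_mul]
    nth_rewrite 2 [h2]
    rw [symMonomial, ← Finset.sum_add_distrib]
    refine Finset.sum_congr rfl fun σ _ => ?_
    rw [prod_pow_eq_pair (fun i => x (σ i)) γ hpq,
      prod_pow_eq_pair (fun i => x (σ (Equiv.swap p q i))) γ hpq, Equiv.swap_apply_left,
      Equiv.swap_apply_right, add_mul]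
    congr 2
    refine Finset.prod_congr rfl fun i hi => ?_
    simp only [Finset.mem_erase, Finset.mem_univ, and_true] at hi
    rw [Equiv.swap_apply_of_ne_of_ne hi.2 hi.1]
  have : 2 * symMonomial x β ≤ 2 * symMonomial x α := by
    rw [key, key]
    refine Finset.sum_le_sum fun σ _ => ?_
    have hr : ∏ i ∈ (Finset.univ.erase p).erase q, x (σ i) ^ β i =
        ∏ i ∈ (Finset.univ.erase p).erase q, x (σ i) ^ α i := by
      refine Finset.prod_congr rfl fun i hi => ?_
      simp only [Finset.mem_erase, Finset.mem_univ, and_true] at hi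
      rw [h i hi.2 hi.1]
    rw [hr, hαp, hαq, hβp, hβq]
    refine mul_le_mul_of_nonneg_right ?_ (Finset.prod_nonneg fun i _ => pow_nonneg (hx _) _)
    have := pow_smoothing (hx (σ p)) (hx (σ q)) hab
    linarith [mul_comm (x (σ q) ^ a) (x (σ p) ^ (b + 1)),
      mul_comm (x (σ q) ^ (a + 1)) (x (σ p) ^ b)]
  linarith

/-- The case of Muirhead's inequality in which the smaller exponent vector is balanced. -/
theorem symMonomial_le_of_balanced {x : ι → ℝ} (hx : ∀ i, 0 ≤ x i) {β : ι → ℕ}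
    (hβ : ∀ i j, β i ≤ β j + 1) :
    ∀ (n : ℕ) (α : ι → ℕ), ∑ i, α i ^ 2 = n → ∑ i, α i = ∑ i, β i →
      symMonomial x β ≤ symMonomial x α := by
  intro n
  induction n using Nat.strong_induction_on with
  | _ n ih =>
    intro α hn hsum
    by_cases hα : ∀ i j, α i ≤ α j + 1
    · obtain ⟨τ, hτ⟩ := exists_perm_of_balanced hα hβ hsum
      rw [← symMonomial_comp_perm x β τ, ← funext hτ]
    · push Not at hα
      obtain ⟨p, q, hpq⟩ := hα
      have hne : p ≠ q := by rintro rfl; omega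
      -- Two exponents differ by at least two, so moving one unit from `p` to `q` does not increase
      -- the symmetrized monomial. It lowers the sum of squares, the induction parameter, by `2c +
      -- 2` with `c = α p - α q - 2`.
      set γ : ι → ℕ := Function.update (Function.update α p (α p - 1)) q (α q + 1) with hγ
      have hγp : γ p = α p - 1 := by simp [hγ, hne]
      have hγq : γ q = α q + 1 := by simp [hγ]
      have hγr : ∀ i, i ≠ p → i ≠ q → γ i = α i := fun i h1 h2 => by simp [hγ, h1, h2]
      have hsplit : ∀ (δ : ι → ℕ) (g : ℕ → ℕ), ∑ i, g (δ i) =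
          g (δ p) + (g (δ q) + ∑ i ∈ (Finset.univ.erase p).erase q, g (δ i)) := fun δ g => by
        rw [Finset.add_sum_erase _ (fun i => g (δ i)) (by simp [hne.symm]),
          Finset.add_sum_erase _ (fun i => g (δ i)) (by simp)]
      have hrest : ∀ g : ℕ → ℕ, ∑ i ∈ (Finset.univ.erase p).erase q, g (γ i) =
          ∑ i ∈ (Finset.univ.erase p).erase q, g (α i) := fun g => by
        refine Finset.sum_congr rfl fun i hi => ?_
        simp only [Finset.mem_erase, Finset.mem_univ, and_true] at hi
        rw [hγr i hi.2 hi.1]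
      obtain ⟨c, hc⟩ : ∃ c, α p = α q + 2 + c := ⟨α p - (α q + 2), by omega⟩
      have h1 : symMonomial x γ ≤ symMonomial x α :=
        symMonomial_smoothing hx hne (a := α q + 1 + c) (b := α q) (by omega) (by omega) rfl
          (by omega) hγq hγr
      refine (ih _ ?_ γ rfl ?_).trans h1
      · rw [← hn, hsplit γ (· ^ 2), hsplit α (· ^ 2), hrest (· ^ 2), hγp, hγq, hc]
        have : α q + 2 + c - 1 = α q + 1 + c := by omega
        rw [this]
        nlinarith
      · have e1 := hsplit γ id
        have e2 := hsplit α id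
        have e3 := hrest id
        simp only [id] at e1 e2 e3
        omega

/-- Expand `(∑ x_i)^k` over words of length `k` and symmetrize. Each nonconstant word contributes at
least the balanced symmetrized monomial, and the constant words account for `∑ x_i^k`. -/
theorem card_mul_symMonomial_le {x : ι → ℝ} (hx : ∀ i, 0 ≤ x i) {β : ι → ℕ}
    (hβ : ∀ i j, β i ≤ β j + 1) (h : 0 < ∑ i, β i) :
    ((Fintype.card ι : ℝ) ^ (∑ i, β i) - Fintype.card ι) * symMonomial x β ≤
      (Fintype.card ι).factorial * ((∑ i, x i) ^ (∑ i, β i) - ∑ i, x i ^ (∑ i, β i)) := by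
  set k := ∑ i, β i with hk
  let g : (Fin k → ι) → ℝ := fun w => ∑ σ : Equiv.Perm ι, ∏ t, x (σ (w t))
  have hg : ∀ w, symMonomial x β ≤ g w := by
    intro w
    have h1 : g w = symMonomial x fun i => (Finset.univ.filter fun t => w t = i).card := by
      refine Finset.sum_congr rfl fun σ _ => ?_
      rw [← Finset.prod_fiberwise Finset.univ w]
      refine Finset.prod_congr rfl fun i _ => ?_
      rw [← Finset.prod_const]
      refine Finset.prod_congr rfl fun t ht => ?_
      rw [(Finset.mem_filter.1 ht).2]
    rw [h1]
    refine symMonomial_le_of_balanced hx hβ _ _ rfl ?_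
    rw [← Finset.card_eq_sum_card_fiberwise (fun _ _ => Finset.mem_coe.2 (Finset.mem_univ _))]
    simp [hk]
  have hall : ∑ w, g w = (Fintype.card ι).factorial * (∑ i, x i) ^ k := by
    rw [Finset.sum_comm, ← Fintype.card_perm, ← nsmul_eq_mul, ← Finset.card_univ,
      ← Finset.sum_const]
    refine Finset.sum_congr rfl fun σ _ => ?_
    rw [← Fintype.sum_pow (fun i => x (σ i)), Equiv.sum_comp σ x]
  -- Constant words are distinct only because `k > 0`.
  have hinj : Function.Injective (fun (i : ι) (_ : Fin k) => i) := fun i j hij =>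
    congrFun hij ⟨0, h⟩
  have hconst : ∑ w ∈ Finset.univ.image (fun (i : ι) (_ : Fin k) => i), g w =
      (Fintype.card ι).factorial * ∑ i, x i ^ k := by
    rw [Finset.sum_image hinj.injOn, Finset.sum_comm, ← Fintype.card_perm, ← nsmul_eq_mul,
      ← Finset.card_univ, ← Finset.sum_const]
    refine Finset.sum_congr rfl fun σ _ => ?_
    simp only [Finset.prod_const, Finset.card_univ, Fintype.card_fin]
    exact Equiv.sum_comp σ fun i => x i ^ k
  have hsub : Finset.univ.image (fun (i : ι) (_ : Fin k) => i) ⊆ Finset.univ :=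
    Finset.subset_univ _
  have hsplit := Finset.sum_sdiff (f := g) hsub
  have hlow : ((Fintype.card ι : ℝ) ^ k - Fintype.card ι) * symMonomial x β ≤
      ∑ w ∈ Finset.univ \ Finset.univ.image (fun (i : ι) (_ : Fin k) => i), g w := by
    refine le_trans (le_of_eq ?_) (Finset.card_nsmul_le_sum _ g _ fun w _ => hg w)
    rw [nsmul_eq_mul, Finset.card_sdiff_of_subset hsub,
      Nat.cast_sub (Finset.card_le_card hsub), Finset.card_image_of_injective _ hinj]
    simp
  rw [mul_sub]
  linarith

end Muirhead

/-! ### Densities and their maxima -/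

namespace DTree

variable {d : ℕ}

theorem density_nonneg (D T : DTree d) : 0 ≤ density D T := by
  unfold density; positivity

theorem density_le_one (D T : DTree d) : density D T ≤ 1 :=
  div_le_one_of_le₀ (by exact_mod_cast copies_le_choose D T) (Nat.cast_nonneg _)

theorem density_mul_choose (D T : DTree d) :
    density D T * (T.numLeaves.choose D.numLeaves : ℝ) = copies D T := by
  -- If `T` is too small, the density is a division by zero, but there are no copies either.
  by_cases h : T.numLeaves.choose D.numLeaves = 0
  · have := copies_le_choose D T
    rw [h, Nat.le_zero] at this
    simp [h, this]
  · exact div_mul_cancel₀ _ (by exact_mod_cast h)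

theorem maxDensity_nonneg (D : DTree d) (n : ℕ) : 0 ≤ maxDensity D n := by
  apply Real.sSup_nonneg
  rintro _ ⟨T, -, -, rfl⟩
  exact density_nonneg D T

theorem maxDensity_le_of_forall {D : DTree d} {n : ℕ} {b : ℝ} (hb : 0 ≤ b)
    (h : ∀ T : DTree d, T.IsDary → T.numLeaves = n → density D T ≤ b) : maxDensity D n ≤ b := by
  apply Real.sSup_le _ hb
  rintro _ ⟨T, hT, hn, rfl⟩
  exact h T hT hn

theorem maxDensity_le_one (D : DTree d) (n : ℕ) : maxDensity D n ≤ 1 :=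
  maxDensity_le_of_forall zero_le_one fun T _ _ => density_le_one D T

theorem density_le_maxDensity (D : DTree d) {T : DTree d} (hT : T.IsDary) :
    density D T ≤ maxDensity D T.numLeaves :=
  le_csSup ⟨1, by rintro _ ⟨T, -, -, rfl⟩; exact density_le_one D T⟩ ⟨T, hT, rfl, rfl⟩

theorem isBoundedUnder_maxDensity (D : DTree d) :
    IsBoundedUnder (· ≤ ·) atTop fun n => maxDensity D n :=
  isBoundedUnder_of ⟨1, maxDensity_le_one D⟩

theorem isCoboundedUnder_maxDensity (D : DTree d) :
    IsCoboundedUnder (· ≤ ·) atTop fun n => maxDensity D n :=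
  (isBoundedUnder_of ⟨0, maxDensity_nonneg D⟩ : IsBoundedUnder (· ≥ ·) _ _).isCoboundedUnder_flip

/-! ### Even trees -/

/-- The index of the `i`-th branch of the even tree of index `n + 1`. -/
def evenIndex (d n : ℕ) (i : Fin d) : ℕ :=
  if (i : ℕ) < d - n % d then n / d else n / d + 1

theorem evenStrict_succ (n : ℕ) :
    evenStrict d (n + 1) = node fun i => evenStrict d (evenIndex d n i) := by
  rw [evenStrict]
  congr 1
  funext i
  rw [evenIndex]
  split_ifs <;> rfl

theorem evenIndex_le (n : ℕ) (i : Fin d) : evenIndex d n i ≤ n := by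
  have hi := i.isLt
  have hle := Nat.div_le_self n d
  rw [evenIndex]
  split_ifs with h
  · exact hle
  · have h1 : n % d ≠ 0 := by omega
    have h2 : n ≠ 0 := by rintro rfl; simp at h1
    have h3 : n % d < d := Nat.mod_lt _ (by omega)
    exact Nat.div_lt_self (Nat.pos_of_ne_zero h2) (by omega)

theorem div_le_evenIndex (n : ℕ) (i : Fin d) : n / d ≤ evenIndex d n i := by
  rw [evenIndex]; split_ifs <;> omega

theorem evenIndex_le_div_add_one (n : ℕ) (i : Fin d) : evenIndex d n i ≤ n / d + 1 := by
  rw [evenIndex]; split_ifs <;> omega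

theorem sum_evenIndex (hd : 0 < d) (n : ℕ) : ∑ i, evenIndex d n i = n := by
  have h1 : ∀ a r : ℕ, ∑ i ∈ Finset.range (a + r), (if i < a then 0 else 1) = r := by
    intro a r
    induction r with
    | zero =>
      exact Finset.sum_eq_zero fun i hi => if_pos (Finset.mem_range.1 hi)
    | succ r ih => rw [← add_assoc, Finset.sum_range_succ, ih, if_neg (by omega)]
  have h2 : ∀ i : Fin d, evenIndex d n i = n / d + (if (i : ℕ) < d - n % d then 0 else 1) := by
    intro i; rw [evenIndex]; split_ifs <;> rfl
  have hlt := Nat.mod_lt n hd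
  have h3 := h1 (d - n % d) (n % d)
  rw [Nat.sub_add_cancel hlt.le] at h3
  simp_rw [h2]
  rw [Finset.sum_add_distrib,
    Fin.sum_univ_eq_sum_range (fun i => if i < d - n % d then 0 else 1) d, h3]
  simp [Nat.div_add_mod]

theorem numLeaves_evenStrict (hd : 0 < d) (n : ℕ) :
    (evenStrict d n).numLeaves = (d - 1) * n + 1 := by
  induction n using Nat.strong_induction_on with
  | _ n ih =>
    cases n with
    | zero => rw [evenStrict]; simp [numLeaves]
    | succ n =>
      rw [evenStrict_succ, numLeaves,
        Finset.sum_congr rfl fun i _ => ih _ (Nat.lt_succ_of_le (evenIndex_le n i)),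
        Finset.sum_add_distrib, ← Finset.mul_sum, sum_evenIndex hd]
      obtain ⟨e, rfl⟩ := Nat.exists_eq_add_of_lt hd
      simp
      ring

theorem evenStrict_ne_empty (n : ℕ) : evenStrict d n ≠ empty := by
  cases n with
  | zero => simp [evenStrict]
  | succ n => simp [evenStrict_succ]

theorem isDary_evenStrict (hd : 2 ≤ d) (n : ℕ) : (evenStrict d n).IsDary := by
  induction n using Nat.strong_induction_on with
  | _ n ih =>
    cases n with
    | zero => rw [evenStrict]; trivial
    | succ n =>
      rw [evenStrict_succ]
      exact ⟨⟨⟨0, by omega⟩, ⟨1, by omega⟩, by simp, evenStrict_ne_empty _, evenStrict_ne_empty _⟩,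
        fun i => ih _ (Nat.lt_succ_of_le (evenIndex_le n i))⟩

/-! ### The upper bound -/

/-- Blowing `T` up by a large `R` multiplies the copies by at least `‖R‖^k`, while the density of
the blow-up is at most any `a > I(D)`. Since `choose n k ≤ n^k / k!`, the factor `‖R‖^k` cancels. -/
theorem copies_le_of_ne_empty (hd : 2 ≤ d) {D T : DTree d} (hD : D.IsDary) (hT : T.IsDary)
    (hT' : T ≠ empty) :
    (copies D T : ℝ) ≤ D.inducibility * ((T.numLeaves : ℝ) ^ D.numLeaves / D.numLeaves.factorial) := by
  have hn : 0 < T.numLeaves := hT.numLeaves_pos hT'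
  have hn' : (0 : ℝ) < T.numLeaves := by exact_mod_cast hn
  rw [← div_le_iff₀ (by positivity)]
  apply le_of_forall_gt_imp_ge_of_dense
  intro a ha
  rw [div_le_iff₀ (by positivity)]
  obtain ⟨N, hN⟩ := eventually_atTop.1
    (eventually_lt_of_limsup_lt ha (isBoundedUnder_maxDensity D))
  set R := evenStrict d N with hR
  have hRN : N < R.numLeaves := by
    rw [hR, numLeaves_evenStrict (by omega)]
    exact Nat.lt_succ_of_le (Nat.le_mul_of_pos_left N (by omega))
  have hB := isDary_blowup (isDary_evenStrict hd N) (evenStrict_ne_empty N) hT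
  have h1 := (density_le_maxDensity D hB).trans
    (hN _ (by rw [numLeaves_blowup]; nlinarith)).le
  have ha' : 0 ≤ a := (density_nonneg _ _).trans h1
  have h2 : (copies D (blowup R T) : ℝ) ≤
      a * (((T.numLeaves * R.numLeaves : ℕ) : ℝ) ^ D.numLeaves / D.numLeaves.factorial) := by
    rw [← density_mul_choose]
    refine mul_le_mul h1 ?_ (Nat.cast_nonneg _) ha'
    rw [numLeaves_blowup]
    exact Nat.choose_le_pow_div _ _
  have h3 : (copies D T : ℝ) * (R.numLeaves : ℝ) ^ D.numLeaves ≤ copies D (blowup R T) := by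
    exact_mod_cast copies_mul_pow_le_copies_blowup R T hD
  have hRpos : (0 : ℝ) < (R.numLeaves : ℝ) ^ D.numLeaves := by
    have : (0 : ℝ) < R.numLeaves := by exact_mod_cast (Nat.zero_le N).trans_lt hRN
    positivity
  refine le_of_mul_le_mul_right (h3.trans (h2.trans (le_of_eq ?_))) hRpos
  push_cast
  ring

theorem inducibility_nonneg (hd : 2 ≤ d) {D : DTree d} (hD : D.IsDary) : 0 ≤ D.inducibility := by
  have h := copies_le_of_ne_empty hd hD (T := leaf) trivial (by simp)
  have h0 : (0 : ℝ) ≤ copies D leaf := Nat.cast_nonneg _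
  have : (0 : ℝ) < (((leaf : DTree d).numLeaves : ℝ) ^ D.numLeaves / D.numLeaves.factorial) := by
    simp [numLeaves]; positivity
  exact nonneg_of_mul_nonneg_left (h0.trans h) this

/-- The density bound by the inducibility holds without error term, since the leaves of a tree
may be replaced by large trees. -/
theorem copies_le (hd : 2 ≤ d) {D T : DTree d} (hD : D.IsDary) (hT : T.IsDary) :
    (copies D T : ℝ) ≤ D.inducibility * ((T.numLeaves : ℝ) ^ D.numLeaves / D.numLeaves.factorial) := by
  by_cases hT' : T = empty
  · subst hT'
    -- For empty `D` the exponent is `0` and `0^0 = 1`, so the case of the one-vertex tree gives the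
    -- same inequality.
    have h := copies_le_of_ne_empty hd hD (T := leaf) trivial (by simp)
    cases D with
    | empty => simpa [copies_empty_left, numLeaves] using h
    | leaf => simp [copies_leaf_left, numLeaves]
    | node g =>
      rw [copies_node_empty, Nat.cast_zero]
      exact mul_nonneg (inducibility_nonneg hd hD) (by positivity)
  · exact copies_le_of_ne_empty hd hD hT hT'

theorem sum_class_eq_sum {g : Fin d → DTree d} {w : ℕ} (x : Fin d → ℝ)
    (hw : ∀ F : Equiv.Perm (Fin d) → ℝ, (∀ π π', (permSetoid (node g)).r π π' → F π = F π') →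
      (w : ℝ) * ∑ q : Quotient (permSetoid (node g)), F q.out = ∑ σ, F σ) :
    (w : ℝ) * ∑ q : Quotient (permSetoid (node g)), ∏ i, x i ^ (g (q.out i)).numLeaves =
      symMonomial x fun i => (g i).numLeaves := by
  rw [hw fun σ => ∏ i, x i ^ (g (σ i)).numLeaves]
  -- Passing to inverses moves the permutation from the exponents to the variables.
  · rw [symMonomial, ← Equiv.sum_comp (Equiv.inv (Equiv.Perm (Fin d)))]
    refine Finset.sum_congr rfl fun σ _ => ?_
    rw [← Equiv.prod_comp σ]
    simp
  · intro π π' h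
    refine Finset.prod_congr rfl fun i _ => ?_
    have := (h i).numLeaves_eq
    simp only [branches] at this
    rw [this]

theorem pow_sub_pos (hd : 2 ≤ d) {k : ℕ} (hk : 2 ≤ k) : (0 : ℝ) < (d : ℝ) ^ k - d := by
  have : (1 : ℝ) < d := by exact_mod_cast hd
  have := pow_lt_pow_right₀ this (show 1 < k by omega)
  linarith

/-- All classes have the same size `w`, so `w * |M| = d!`, and `w` cancels from the symmetrized
inequality. -/
theorem sum_class_mul_le (hd : 2 ≤ d) {g : Fin d → DTree d} (hg : (node g).IsDary)
    (hbal : (node g).IsBalanced) {x : Fin d → ℝ} (hx : ∀ i, 0 ≤ x i) :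
    ∑ q : Quotient (permSetoid (node g)), ∏ i, x i ^ (g (q.out i)).numLeaves ≤
      (cardM (node g) : ℝ) / ((d : ℝ) ^ (node g).numLeaves - d) *
        ((∑ i, x i) ^ (node g).numLeaves - ∑ i, x i ^ (node g).numLeaves) := by
  have hk := two_le_numLeaves_node hg
  have hpos := pow_sub_pos hd hk
  obtain ⟨w, hw0, hw⟩ := exists_card_class (node g)
  have hw0' : (0 : ℝ) < w := by exact_mod_cast hw0
  have h1 := sum_class_eq_sum x hw
  have h2 : (w : ℝ) * cardM (node g) = d.factorial := by
    have := hw (fun _ => 1) fun _ _ _ => rfl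
    rw [Finset.sum_const, Finset.sum_const, Finset.card_univ, Finset.card_univ,
      Fintype.card_perm, Fintype.card_fin, nsmul_eq_mul, nsmul_eq_mul, mul_one, mul_one] at this
    rw [cardM, Nat.card_eq_fintype_card]
    exact this
  have h3 := card_mul_symMonomial_le hx (β := fun i => (g i).numLeaves)
    (fun i j => by
      have := (abs_le.1 (hbal i j)).2
      simp only [branches] at this
      omega)
    (by have : (node g).numLeaves = ∑ i, (g i).numLeaves := rfl
        omega)
  rw [Fintype.card_fin, ← h1, ← h2] at h3
  change ((d : ℝ) ^ (node g).numLeaves - d) * _ ≤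
    w * cardM (node g) * ((∑ i, x i) ^ (node g).numLeaves - ∑ i, x i ^ (node g).numLeaves) at h3
  rw [div_mul_eq_mul_div, le_div_iff₀ hpos]
  refine le_of_mul_le_mul_left ?_ hw0'
  linarith

theorem prod_perm_div (g : Fin d → DTree d) (a : DTree d → ℝ) (σ : Equiv.Perm (Fin d))
    (x : Fin d → ℝ) :
    ∏ i, (a (g (σ i)) * (x i ^ (g (σ i)).numLeaves / (g (σ i)).numLeaves.factorial)) =
      (∏ i, a (g i) / (g i).numLeaves.factorial) * ∏ i, x i ^ (g (σ i)).numLeaves := by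
  rw [← Equiv.prod_comp σ fun i => a (g i) / (g i).numLeaves.factorial, ← Finset.prod_mul_distrib]
  exact Finset.prod_congr rfl fun i _ => by ring

/-- Induction on `T` closes with the same constant `C`: the branches contribute at most `C ∑ x_i^k`,
the split copies at most `C ((∑ x_i)^k - ∑ x_i^k)`. -/
theorem copies_node_le (hd : 2 ≤ d) {g : Fin d → DTree d} (hg : (node g).IsDary)
    (hbal : (node g).IsBalanced) : ∀ {T : DTree d}, T.IsDary →
    (copies (node g) T : ℝ) ≤ (cardM (node g) : ℝ) / ((d : ℝ) ^ (node g).numLeaves - d) *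
      (∏ i, (g i).inducibility / (g i).numLeaves.factorial) *
        (T.numLeaves : ℝ) ^ (node g).numLeaves := by
  have hpos := pow_sub_pos hd (two_le_numLeaves_node hg)
  have hP : 0 ≤ ∏ i, (g i).inducibility / (g i).numLeaves.factorial :=
    Finset.prod_nonneg fun i _ => div_nonneg (inducibility_nonneg hd (hg.2 i)) (Nat.cast_nonneg _)
  intro T
  induction T with
  | empty => intro _; rw [copies_node_empty]; push_cast; positivity
  | leaf => intro _; rw [copies_node_leaf]; push_cast; positivity
  | node f ih =>
    intro hT
    rw [copies_node hg]
    push_cast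
    have h1 := Finset.sum_le_sum fun i (_ : i ∈ Finset.univ) => ih i (hT.2 i)
    have h2 : ∑ q : Quotient (permSetoid (node g)), ∏ i, (copies (g (q.out i)) (f i) : ℝ) ≤
        (∏ i, (g i).inducibility / (g i).numLeaves.factorial) *
          ∑ q : Quotient (permSetoid (node g)),
            ∏ i, ((f i).numLeaves : ℝ) ^ (g (q.out i)).numLeaves := by
      rw [Finset.mul_sum]
      refine Finset.sum_le_sum fun q _ => ?_
      rw [← prod_perm_div g inducibility q.out]
      exact Finset.prod_le_prod (fun i _ => Nat.cast_nonneg _)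
        fun i _ => copies_le hd (hg.2 _) (hT.2 i)
    have h3 := mul_le_mul_of_nonneg_left
      (sum_class_mul_le hd hg hbal (x := fun i => ((f i).numLeaves : ℝ))
        fun i => Nat.cast_nonneg _) hP
    rw [← Finset.mul_sum] at h1
    have h4 : ((node f).numLeaves : ℝ) = ∑ i, ((f i).numLeaves : ℝ) := by
      simp [numLeaves]
    rw [h4]
    linarith

theorem tendsto_pow_div_choose (k : ℕ) :
    Tendsto (fun n : ℕ => (n : ℝ) ^ k / (n.choose k : ℝ)) atTop (𝓝 k.factorial) := by
  have h := (isEquivalent_choose k).symm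
  have h1 : ∀ᶠ n : ℕ in atTop, (n.choose k : ℝ) ≠ 0 := by
    filter_upwards [eventually_ge_atTop k] with n hn
    exact_mod_cast (Nat.choose_pos hn).ne'
  have h2 := (Asymptotics.isEquivalent_iff_tendsto_one h1).1 h
  have h3 := h2.const_mul (k.factorial : ℝ)
  rw [mul_one] at h3
  refine h3.congr fun n => ?_
  simp only [Pi.div_apply]
  have : (k.factorial : ℝ) ≠ 0 := by exact_mod_cast k.factorial_ne_zero
  field_simp

theorem factorial_eq_mul_multinomial (g : Fin d → DTree d) :
    ((node g).numLeaves.factorial : ℝ) = (∏ i, ((g i).numLeaves.factorial : ℝ)) *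
      Nat.multinomial Finset.univ fun i => (g i).numLeaves := by
  have := Nat.multinomial_spec Finset.univ fun i => (g i).numLeaves
  exact_mod_cast this.symm

theorem inducibility_node_le (hd : 2 ≤ d) {g : Fin d → DTree d} (hg : (node g).IsDary)
    (hbal : (node g).IsBalanced) :
    (node g).inducibility ≤ (cardM (node g) : ℝ) / ((d : ℝ) ^ (node g).numLeaves - d) *
      (Nat.multinomial Finset.univ fun i => (g i).numLeaves : ℕ) *
        ∏ i, (g i).inducibility := by
  have hpos := pow_sub_pos hd (two_le_numLeaves_node hg)
  have hP : 0 ≤ ∏ i, (g i).inducibility / (g i).numLeaves.factorial :=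
    Finset.prod_nonneg fun i _ => div_nonneg (inducibility_nonneg hd (hg.2 i)) (Nat.cast_nonneg _)
  have hlim := (tendsto_pow_div_choose (node g).numLeaves).const_mul
    ((cardM (node g) : ℝ) / ((d : ℝ) ^ (node g).numLeaves - d) *
      (∏ i, (g i).inducibility / (g i).numLeaves.factorial))
  have hle : ∀ n, maxDensity (node g) n ≤ (cardM (node g) : ℝ) /
      ((d : ℝ) ^ (node g).numLeaves - d) *
      (∏ i, (g i).inducibility / (g i).numLeaves.factorial) *
        ((n : ℝ) ^ (node g).numLeaves / (n.choose (node g).numLeaves : ℝ)) := by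
    intro n
    apply maxDensity_le_of_forall (by positivity)
    rintro T hT rfl
    rw [← mul_div_assoc, density]
    exact div_le_div_of_nonneg_right (copies_node_le hd hg hbal hT) (Nat.cast_nonneg _)
  have h := limsup_le_limsup (Eventually.of_forall hle) (isCoboundedUnder_maxDensity _)
    hlim.isBoundedUnder_le
  rw [hlim.limsup_eq] at h
  refine h.trans (le_of_eq ?_)
  have hf : (∏ i, ((g i).numLeaves.factorial : ℝ)) ≠ 0 :=
    Finset.prod_ne_zero_iff.2 fun i _ => by exact_mod_cast Nat.factorial_ne_zero _
  rw [factorial_eq_mul_multinomial, Finset.prod_div_distrib]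
  field_simp

end DTree

/-! ### Contracting recursions -/

/-- A bounded sequence defined by a contracting weighted average of earlier terms plus a
convergent inhomogeneity converges. -/
theorem tendsto_of_contracting_recursion {ι : Type*} [Fintype ι] {r h : ℕ → ℝ} {C ω l : ℝ}
    {w : ι → ℕ → ℝ} {s : ι → ℕ → ℕ} (hr : ∀ n, |r n| ≤ C) (hω : 0 ≤ ω)
    (hω' : Fintype.card ι * ω < 1) (hw : ∀ j, Tendsto (w j) atTop (𝓝 ω))
    (hs : ∀ j, Tendsto (s j) atTop atTop) (hh : Tendsto h atTop (𝓝 l))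
    (hrec : ∀ n, r (n + 1) = ∑ j, w j n * r (s j n) + h n) :
    Tendsto r atTop (𝓝 (l / (1 - Fintype.card ι * ω))) := by
  -- `L` is the fixed point of the limiting recursion `L = |ι| ω L + l`.
  set L := l / (1 - Fintype.card ι * ω) with hL
  set e : ℕ → ℝ := fun n => |r n - L| with he
  have hbd : IsBoundedUnder (· ≤ ·) atTop e := isBoundedUnder_of ⟨C + |L|, fun n =>
    (abs_sub _ _).trans (by linarith [hr n])⟩
  have hbd' : IsBoundedUnder (· ≥ ·) atTop e := isBoundedUnder_of ⟨0, fun n => abs_nonneg _⟩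
  have hδ : Tendsto (fun n => |h n - L * (1 - ∑ j, w j n)|) atTop (𝓝 0) := by
    have h1 := (hh.sub (((tendsto_finsetSum Finset.univ fun j _ => hw j).const_sub 1).const_mul
      L)).abs
    have h2 : l - L * (1 - ∑ _j : ι, ω) = 0 := by
      rw [hL, Finset.sum_const, Finset.card_univ, nsmul_eq_mul,
        div_mul_cancel₀ _ (by linarith : (1 - Fintype.card ι * ω) ≠ 0), sub_self]
    rwa [h2, abs_zero] at h1
  have hstep : ∀ n, e (n + 1) ≤ ∑ j, |w j n| * e (s j n) + |h n - L * (1 - ∑ j, w j n)| := by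
    intro n
    have h1 : r (n + 1) - L = ∑ j, w j n * (r (s j n) - L) + (h n - L * (1 - ∑ j, w j n)) := by
      simp only [hrec, mul_sub, Finset.sum_sub_distrib, ← Finset.sum_mul]
      ring
    simp only [he, h1]
    refine (abs_add_le _ _).trans (add_le_add_left ((Finset.abs_sum_le_sum_abs _ _).trans
      (le_of_eq ?_)) _)
    exact Finset.sum_congr rfl fun j _ => abs_mul _ _
  -- Eventually all earlier errors are below `t`, so one step of the recursion contracts the bound.
  -- Letting `t` decrease to the limsup forces it to be at most `0`.
  have hS : ∀ t, limsup e atTop < t → limsup e atTop ≤ Fintype.card ι * ω * t := by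
    intro t ht
    have h1 : ∀ᶠ n in atTop, ∀ j, e (s j n) < t :=
      eventually_all.2 fun j => (hs j).eventually (eventually_lt_of_limsup_lt ht hbd)
    have h2 : ∀ᶠ n in atTop, e (n + 1) ≤ ∑ j, |w j n| * t + |h n - L * (1 - ∑ j, w j n)| := by
      filter_upwards [h1] with n hn
      refine (hstep n).trans (add_le_add_left (Finset.sum_le_sum fun j _ => ?_) _)
      exact mul_le_mul_of_nonneg_left (hn j).le (abs_nonneg _)
    have h3 := (tendsto_finsetSum Finset.univ fun j _ => (hw j).abs.mul_const t).add hδ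
    have h4 : ∑ _j : ι, |ω| * t + 0 = Fintype.card ι * ω * t := by
      rw [Finset.sum_const, Finset.card_univ, nsmul_eq_mul, abs_of_nonneg hω]; ring
    rw [h4] at h3
    rw [← limsup_nat_add e 1, ← h3.limsup_eq]
    refine limsup_le_limsup h2 ?_ h3.isBoundedUnder_le
    exact (isBoundedUnder_of ⟨0, fun n => abs_nonneg _⟩ :
      IsBoundedUnder (· ≥ ·) atTop fun n => e (n + 1)).isCoboundedUnder_flip
  have hS0 : limsup e atTop ≤ 0 := by
    by_contra hpos
    push Not at hpos
    set S := limsup e atTop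
    have h1 : S ≤ Fintype.card ι * ω * S := by
      have h2 : Tendsto (fun t => Fintype.card ι * ω * t) (𝓝[>] S) (𝓝 (Fintype.card ι * ω * S)) :=
        ((continuous_const.mul continuous_id).tendsto S).mono_left nhdsWithin_le_nhds
      exact ge_of_tendsto h2 (eventually_nhdsWithin_of_forall fun t ht => hS t ht)
    nlinarith
  have he0 : Tendsto e atTop (𝓝 0) :=
    tendsto_of_le_liminf_of_limsup_le
      (le_liminf_of_le hbd.isCoboundedUnder_flip (Eventually.of_forall fun n => abs_nonneg _))
      hS0 hbd hbd'
  exact tendsto_sub_nhds_zero_iff.1 ((tendsto_zero_iff_abs_tendsto_zero _).2 he0)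

/-! ### Limits along the even trees -/

namespace DTree

variable {d : ℕ}

theorem tendsto_evenIndex (hd : 2 ≤ d) (i : Fin d) :
    Tendsto (fun n => evenIndex d n i) atTop atTop :=
  tendsto_atTop_mono (fun n => div_le_evenIndex n i) (Nat.tendsto_div_const_atTop (by omega))

theorem lt_numLeaves_evenStrict (hd : 2 ≤ d) (n : ℕ) : n < (evenStrict d n).numLeaves := by
  rw [numLeaves_evenStrict (by omega)]
  exact Nat.lt_succ_of_le (Nat.le_mul_of_pos_left n (by omega))

theorem tendsto_numLeaves_evenStrict (hd : 2 ≤ d) :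
    Tendsto (fun n => (evenStrict d n).numLeaves) atTop atTop :=
  tendsto_atTop_mono (fun n => (lt_numLeaves_evenStrict hd n).le) tendsto_id

theorem tendsto_numLeaves_ratio (hd : 2 ≤ d) (i : Fin d) :
    Tendsto (fun n => ((evenStrict d (evenIndex d n i)).numLeaves : ℝ) /
      (evenStrict d (n + 1)).numLeaves) atTop (𝓝 (d : ℝ)⁻¹) := by
  have hd0 : (0 : ℝ) < d := by exact_mod_cast (by omega : 0 < d)
  rw [tendsto_iff_dist_tendsto_zero]
  have hlim : Tendsto (fun n : ℕ => (d : ℝ) * ((n : ℝ) + 1)⁻¹) atTop (𝓝 0) := by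
    have := (tendsto_one_div_add_atTop_nhds_zero_nat (𝕜 := ℝ)).const_mul (d : ℝ)
    simpa using this
  refine squeeze_zero (fun _ => dist_nonneg) (fun n => ?_) hlim
  have hN : (n : ℝ) + 1 < (evenStrict d (n + 1)).numLeaves := by
    exact_mod_cast lt_numLeaves_evenStrict hd (n + 1)
  have hN0 : (0 : ℝ) < (evenStrict d (n + 1)).numLeaves := by
    have : (0 : ℝ) ≤ n := Nat.cast_nonneg n
    linarith
  have hcast : ∀ m, ((evenStrict d m).numLeaves : ℝ) = (d - 1) * m + 1 := fun m => by
    rw [numLeaves_evenStrict (by omega)]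
    push_cast [Nat.cast_sub (show 1 ≤ d by omega)]
    ring
  have h1 : |(d : ℝ) * evenIndex d n i - n| ≤ d := by
    have e1 := div_le_evenIndex n i
    have e2 := evenIndex_le_div_add_one n i
    have e3 := Nat.div_add_mod n d
    have e4 := Nat.mod_lt n (show 0 < d by omega)
    have e5 : d * (n / d) ≤ d * evenIndex d n i := Nat.mul_le_mul_left d e1
    have e6 : d * evenIndex d n i ≤ d * (n / d) + d := by
      have := Nat.mul_le_mul_left d e2
      rwa [Nat.mul_add, mul_one] at this
    have e7 : d * evenIndex d n i ≤ n + d := by omega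
    have e8 : n ≤ d * evenIndex d n i + d := by omega
    have e7' : (d : ℝ) * evenIndex d n i ≤ n + d := by exact_mod_cast e7
    have e8' : (n : ℝ) ≤ d * evenIndex d n i + d := by exact_mod_cast e8
    rw [abs_le]
    constructor <;> linarith
  have hd1 : (0 : ℝ) ≤ d - 1 := by
    have : (2 : ℝ) ≤ d := by exact_mod_cast hd
    linarith
  -- The additive constants of the leaf counts cancel exactly, leaving an error of at most `d / (n +
  -- 1)`.
  have h2 : ((evenStrict d (evenIndex d n i)).numLeaves : ℝ) / (evenStrict d (n + 1)).numLeaves -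
      (d : ℝ)⁻¹ = (d - 1) * (d * evenIndex d n i - n) /
        (d * (evenStrict d (n + 1)).numLeaves) := by
    have e := hcast (n + 1)
    field_simp
    rw [e, hcast]
    push_cast
    ring
  rw [Real.dist_eq, h2, abs_div, abs_mul, abs_of_nonneg hd1,
    abs_of_pos (mul_pos hd0 hN0), div_le_iff₀ (mul_pos hd0 hN0)]
  have h3 : (d - 1) * |(d : ℝ) * evenIndex d n i - n| ≤ d * d := by
    refine mul_le_mul (by linarith) h1 (abs_nonneg _) hd0.le
  refine h3.trans ?_
  have h4 : 1 ≤ ((n : ℝ) + 1)⁻¹ * (evenStrict d (n + 1)).numLeaves := by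
    have : (0 : ℝ) < (n : ℝ) + 1 := by positivity
    rw [inv_mul_eq_div, one_le_div this]
    exact hN.le
  have h5 := mul_le_mul_of_nonneg_left h4 (mul_pos hd0 hd0).le
  linarith

theorem tendsto_choose_div_pow (hd : 2 ≤ d) (i : Fin d) (a : ℕ) :
    Tendsto (fun n => (((evenStrict d (evenIndex d n i)).numLeaves.choose a : ℕ) : ℝ) /
      ((evenStrict d (n + 1)).numLeaves : ℝ) ^ a) atTop
      (𝓝 ((a.factorial : ℝ)⁻¹ * ((d : ℝ)⁻¹) ^ a)) := by
  have ha : (a.factorial : ℝ) ≠ 0 := by exact_mod_cast a.factorial_ne_zero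
  have h1 := ((tendsto_pow_div_choose a).inv₀ ha).comp
    ((tendsto_numLeaves_evenStrict hd).comp (tendsto_evenIndex hd i))
  refine (h1.mul ((tendsto_numLeaves_ratio hd i).pow a)).congr fun n => ?_
  have h2 : ((evenStrict d (evenIndex d n i)).numLeaves : ℝ) ≠ 0 := by
    exact_mod_cast ((Nat.zero_le _).trans_lt (lt_numLeaves_evenStrict hd _)).ne'
  simp only [Function.comp_apply, inv_div, div_pow]
  rw [div_mul_div_comm, mul_comm (_ ^ a) (_ ^ a), mul_div_mul_right _ _ (pow_ne_zero a h2)]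

theorem tendsto_choose_ratio (hd : 2 ≤ d) (i : Fin d) (k : ℕ) :
    Tendsto (fun n => (((evenStrict d (evenIndex d n i)).numLeaves.choose k : ℕ) : ℝ) /
      ((evenStrict d (n + 1)).numLeaves.choose k : ℕ)) atTop (𝓝 (((d : ℝ)⁻¹) ^ k)) := by
  have h1 := (tendsto_pow_div_choose k).comp
    ((tendsto_numLeaves_evenStrict hd).comp (tendsto_add_atTop_nat 1))
  have h2 := (tendsto_choose_div_pow hd i k).mul h1
  have hk : (k.factorial : ℝ) ≠ 0 := by exact_mod_cast k.factorial_ne_zero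
  rw [mul_right_comm, inv_mul_cancel₀ hk, one_mul] at h2
  refine h2.congr fun n => ?_
  have h3 : ((evenStrict d (n + 1)).numLeaves : ℝ) ≠ 0 := by
    exact_mod_cast ((Nat.zero_le _).trans_lt (lt_numLeaves_evenStrict hd _)).ne'
  simp only [Function.comp_apply]
  rw [div_mul_div_cancel₀ (pow_ne_zero k h3)]

/-- The factors `d^{-a}` multiply to `d^{-k}` and the factorials combine to the multinomial
coefficient, so the limit is the same for every `σ`. -/
theorem tendsto_prod_choose_ratio (hd : 2 ≤ d) (g : Fin d → DTree d) (σ : Equiv.Perm (Fin d)) :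
    Tendsto (fun n => (∏ i, (((evenStrict d (evenIndex d n i)).numLeaves.choose
        (g (σ i)).numLeaves : ℕ) : ℝ)) /
      ((evenStrict d (n + 1)).numLeaves.choose (node g).numLeaves : ℕ)) atTop
      (𝓝 ((Nat.multinomial Finset.univ fun i => (g i).numLeaves : ℕ) *
        ((d : ℝ)⁻¹) ^ (node g).numLeaves)) := by
  have hk : (node g).numLeaves = ∑ i, (g (σ i)).numLeaves := by
    rw [numLeaves, Equiv.sum_comp σ fun i => (g i).numLeaves]
  have h1 := (tendsto_pow_div_choose (node g).numLeaves).comp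
    ((tendsto_numLeaves_evenStrict hd).comp (tendsto_add_atTop_nat 1))
  have h2 := (tendsto_finsetProd Finset.univ fun i _ =>
    tendsto_choose_div_pow hd i (g (σ i)).numLeaves).mul h1
  have hf : (∏ i, ((g i).numLeaves.factorial : ℝ)) ≠ 0 :=
    Finset.prod_ne_zero_iff.2 fun i _ => by exact_mod_cast Nat.factorial_ne_zero _
  have hval : (∏ i, (((g (σ i)).numLeaves.factorial : ℝ)⁻¹ * ((d : ℝ)⁻¹) ^ (g (σ i)).numLeaves)) *
      (node g).numLeaves.factorial =
      (Nat.multinomial Finset.univ fun i => (g i).numLeaves : ℕ) *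
        ((d : ℝ)⁻¹) ^ (node g).numLeaves := by
    rw [Finset.prod_mul_distrib, Finset.prod_pow_eq_pow_sum, ← hk,
      Equiv.prod_comp σ fun i => ((g i).numLeaves.factorial : ℝ)⁻¹, Finset.prod_inv_distrib,
      factorial_eq_mul_multinomial]
    field_simp
  rw [hval] at h2
  refine h2.congr fun n => ?_
  have h3 : ((evenStrict d (n + 1)).numLeaves : ℝ) ≠ 0 := by
    exact_mod_cast ((Nat.zero_le _).trans_lt (lt_numLeaves_evenStrict hd _)).ne'
  simp only [Function.comp_apply]
  rw [Finset.prod_div_distrib, Finset.prod_pow_eq_pow_sum, ← hk,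
    div_mul_div_cancel₀ (pow_ne_zero _ h3)]

theorem density_evenStrict_succ {g : Fin d → DTree d} (hg : (node g).IsDary) (n : ℕ) :
    density (node g) (evenStrict d (n + 1)) =
      ∑ i, (((evenStrict d (evenIndex d n i)).numLeaves.choose (node g).numLeaves : ℕ) : ℝ) /
          ((evenStrict d (n + 1)).numLeaves.choose (node g).numLeaves : ℕ) *
            density (node g) (evenStrict d (evenIndex d n i)) +
        ∑ q : Quotient (permSetoid (node g)),
          (∏ i, density (g (q.out i)) (evenStrict d (evenIndex d n i))) *
          ((∏ i, (((evenStrict d (evenIndex d n i)).numLeaves.choose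
            (g (q.out i)).numLeaves : ℕ) : ℝ)) /
          ((evenStrict d (n + 1)).numLeaves.choose (node g).numLeaves : ℕ)) := by
  have h : (copies (node g) (evenStrict d (n + 1)) : ℝ) =
      ∑ i, (copies (node g) (evenStrict d (evenIndex d n i)) : ℝ) +
        ∑ q : Quotient (permSetoid (node g)),
          ∏ i, (copies (g (q.out i)) (evenStrict d (evenIndex d n i)) : ℝ) := by
    rw [evenStrict_succ, copies_node hg]
    push_cast
    rfl
  rw [density, h, add_div, Finset.sum_div, Finset.sum_div]
  congr 1
  · refine Finset.sum_congr rfl fun i _ => ?_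
    rw [← density_mul_choose]
    ring
  · refine Finset.sum_congr rfl fun q _ => ?_
    rw [← mul_div_assoc, ← Finset.prod_mul_distrib]
    simp only [density_mul_choose]

theorem tendsto_density_node (hd : 2 ≤ d) {g : Fin d → DTree d} (hg : (node g).IsDary)
    {l : Fin d → ℝ} (hl : ∀ i, Tendsto (fun n => density (g i) (evenStrict d n)) atTop (𝓝 (l i))) :
    Tendsto (fun n => density (node g) (evenStrict d n)) atTop
      (𝓝 ((cardM (node g) : ℝ) / ((d : ℝ) ^ (node g).numLeaves - d) *
        (Nat.multinomial Finset.univ fun i => (g i).numLeaves : ℕ) * ∏ i, l i)) := by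
  have hd0 : (0 : ℝ) < d := by exact_mod_cast (by omega : 0 < d)
  have hpos := pow_sub_pos hd (two_le_numLeaves_node hg)
  -- The contraction condition `d * d^{-k} < 1`, which holds because `k ≥ 2`.
  have hω' : (Fintype.card (Fin d) : ℝ) * ((d : ℝ)⁻¹) ^ (node g).numLeaves < 1 := by
    rw [Fintype.card_fin, inv_pow, ← div_eq_mul_inv, div_lt_one (by positivity)]
    linarith
  have hh := tendsto_finsetSum Finset.univ fun (q : Quotient (permSetoid (node g))) _ =>
    (tendsto_finsetProd Finset.univ fun i _ =>
      (hl (q.out i)).comp (tendsto_evenIndex hd i)).mul (tendsto_prod_choose_ratio hd g q.out)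
  have main := tendsto_of_contracting_recursion
    (r := fun n => density (node g) (evenStrict d n)) (C := 1)
    (fun n => by rw [abs_of_nonneg (density_nonneg _ _)]; exact density_le_one _ _)
    (by positivity) hω' (fun i => tendsto_choose_ratio hd i (node g).numLeaves)
    (tendsto_evenIndex hd) hh (density_evenStrict_succ hg)
  convert main using 2
  have hq : ∀ q : Quotient (permSetoid (node g)), ∏ i, l (q.out i) = ∏ i, l i := fun q =>
    Equiv.prod_comp q.out l
  simp only [hq]
  rw [Finset.sum_const, Finset.card_univ, nsmul_eq_mul, cardM, Nat.card_eq_fintype_card,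
    Fintype.card_fin]
  rw [inv_pow]
  have h1 : (1 : ℝ) - d * ((d : ℝ) ^ (node g).numLeaves)⁻¹ =
      ((d : ℝ) ^ (node g).numLeaves - d) / (d : ℝ) ^ (node g).numLeaves := by
    field_simp
  rw [h1]
  field_simp

theorem density_eq_one {D T : DTree d} (h : D = empty ∨ D = leaf) (hT : 0 < T.numLeaves) :
    density D T = 1 := by
  have hT' : (T.numLeaves : ℝ) ≠ 0 := by exact_mod_cast hT.ne'
  rcases h with rfl | rfl
  · simp [density, copies_empty_left, numLeaves]
  · simp [density, copies_leaf_left, numLeaves, hT']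

theorem tendsto_density_of_le_one (hd : 2 ≤ d) {D : DTree d} (h : D = empty ∨ D = leaf) :
    Tendsto (fun n => density D (evenStrict d n)) atTop (𝓝 1) :=
  tendsto_const_nhds.congr fun n =>
    (density_eq_one h ((Nat.zero_le n).trans_lt (lt_numLeaves_evenStrict hd n))).symm

/-- The limit defining `η_d(D)` exists for every `d`-ary tree. -/
theorem tendsto_eta (hd : 2 ≤ d) : ∀ {D : DTree d}, D.IsDary →
    Tendsto (fun n => density D (evenStrict d n)) atTop (𝓝 D.eta) := by
  intro D
  induction D with
  | empty => exact fun _ => tendsto_nhds_limUnder ⟨1, tendsto_density_of_le_one hd (Or.inl rfl)⟩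
  | leaf => exact fun _ => tendsto_nhds_limUnder ⟨1, tendsto_density_of_le_one hd (Or.inr rfl)⟩
  | node g ih =>
    exact fun hg => tendsto_nhds_limUnder ⟨_, tendsto_density_node hd hg fun i => ih i (hg.2 i)⟩

theorem eta_node (hd : 2 ≤ d) {g : Fin d → DTree d} (hg : (node g).IsDary) :
    (node g).eta = (cardM (node g) : ℝ) / ((d : ℝ) ^ (node g).numLeaves - d) *
      (Nat.multinomial Finset.univ fun i => (g i).numLeaves : ℕ) * ∏ i, (g i).eta :=
  tendsto_nhds_unique (tendsto_eta hd hg)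
    (tendsto_density_node hd hg fun i => tendsto_eta hd (hg.2 i))

/-- Even trees compete in the maximum for infinitely many sizes, which is enough to bound a limsup
from below. -/
theorem eta_le_inducibility (hd : 2 ≤ d) {D : DTree d} (hD : D.IsDary) :
    D.eta ≤ D.inducibility := by
  apply le_of_forall_gt_imp_ge_of_dense
  intro a ha
  refine le_of_tendsto (tendsto_eta hd hD) ?_
  filter_upwards [(tendsto_numLeaves_evenStrict hd).eventually
    (eventually_lt_of_limsup_lt ha (isBoundedUnder_maxDensity D))] with n hn
  exact (density_le_maxDensity D (isDary_evenStrict hd n)).trans hn.le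

theorem inducibility_le_one (D : DTree d) : D.inducibility ≤ 1 :=
  limsup_le_of_le (isCoboundedUnder_maxDensity D) (Eventually.of_forall (maxDensity_le_one D))

theorem inducibility_eq_eta_of_le_one (hd : 2 ≤ d) {D : DTree d} (hD : D.IsDary)
    (h : D = empty ∨ D = leaf) : D.inducibility = D.eta := by
  apply le_antisymm _ (eta_le_inducibility hd hD)
  rw [tendsto_nhds_unique (tendsto_eta hd hD) (tendsto_density_of_le_one hd h)]
  exact inducibility_le_one D

end DTree

theorem theorem6 (d : ℕ) (hd : 2 ≤ d) (D : DTree d) (hD : D.IsDary) (hbal : D.IsBalanced) :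
    (2 ≤ D.numLeaves →
      D.inducibility ≤
        (D.cardM : ℝ) / ((d : ℝ) ^ D.numLeaves - (d : ℝ)) *
          (Nat.multinomial Finset.univ (fun i : Fin d => (D.branches i).numLeaves) : ℝ) *
          ∏ i : Fin d, (D.branches i).inducibility) ∧
    ((∀ i : Fin d, (D.branches i).inducibility = (D.branches i).eta) →
      Tendsto (fun n : ℕ => DTree.density D (DTree.evenStrict d n)) atTop (𝓝 D.eta) ∧
        D.inducibility = D.eta) := by
  cases D with
  | empty =>
    exact ⟨fun h => by simp [DTree.numLeaves] at h, fun _ => ⟨DTree.tendsto_eta hd hD,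
      DTree.inducibility_eq_eta_of_le_one hd hD (Or.inl rfl)⟩⟩
  | leaf =>
    exact ⟨fun h => by simp [DTree.numLeaves] at h, fun _ => ⟨DTree.tendsto_eta hd hD,
      DTree.inducibility_eq_eta_of_le_one hd hD (Or.inr rfl)⟩⟩
  | node g =>
    refine ⟨fun _ => DTree.inducibility_node_le hd hD hbal, fun h =>
      ⟨DTree.tendsto_eta hd hD, le_antisymm ?_ (DTree.eta_le_inducibility hd hD)⟩⟩
    -- With equal values on the branches, the formula for `η_d(D)` is the upper bound for `I_d(D)`.
    have h' : ∏ i, (g i).eta = ∏ i, (g i).inducibility :=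
      Finset.prod_congr rfl fun i _ => (h i).symm
    rw [DTree.eta_node hd hD, h']
    exact DTree.inducibility_node_le hd hD hbal
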